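/- Let $\beta>1$ be a real number and put $A_\beta=\{0,1,\dots,\lceil\beta\rceil-1\}$ and $\tilde A_\beta=\{-(\lceil\beta\rceil-1),\dots,\lceil\beta\rceil-1\}$. **Parry numbers.** Let $d_\beta^*(1)$ be the lexicographically greatest word $w_1w_2\cdots\in A_\beta^{\omega}$ that does not end in $0^\omega$ and satisfies $\sum_{i\ge1}w_i\beta^{-i}=1$. The number $\beta$ is a Parry number if $d_\beta^*(1)$ is ultimately periodic. **$\beta$-expansions.** The $\beta$-expansion of a real $x\ge 0$ is the word $d_\beta(x)=x_k\cdots x_0\star x_{-1}x_{-2}\cdots$ with $k\ge0$ minimal such that $x_i\in A_\beta$ for all $i\le k$, $x=\sum_{i\le k}x_i\beta^i$, and $\sum_{i\le \ell}x_i\beta^i<\beta^{\ell+1}$ for all $\ell\le k$. For $x<0$, $d_\beta(x)$ is obtained from $d_\beta(-x)$ by replacing each digit $a$ by $-a$. For $n\ge 1$ and $\mathbf x=(x_1,\dots,x_n)\in\mathbb R^n$, the word $d_\beta(\mathbf x)$ over the alphabet $(\tilde A_\beta)^n\cup\{\boldsymbol\star\}$ is obtained from $d_\beta(x_1),\dots,d_\beta(x_n)$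 by padding them with leading zeroes so that all the symbols $\star$ occur at the same position, and reading them in parallel; it does not start with $\mathbf 0=(0,\dots,0)$, except if $|x_i|<1$ for all $i$, in which case it starts with $\mathbf 0\boldsymbol\star$. **Recognizability.** A set $X\subseteq\mathbb R^n$ is $\beta$-recognizable if there is a (finite, possibly nondeterministic) Büchi automaton over $(\tilde A_\beta)^n\cup\{\boldsymbol\star\}$ whose accepted language of infinite words is exactly $d_\beta(X)=\{d_\beta(\mathbf x)\mid \mathbf x\in X\}$. **Definability.** For $a\in\tilde A_\beta$ let $X_{\beta,a}(x,y)$ be the binary predicate on $\mathbb R$ which holds if and only if $y$ is an integral power of $\beta$ and either $|x|<y$ and $a=0$, or $|x|\ge y$ and, writing $y=\beta^i$ with $i\in\mathbb Z$, the digit $x_i$ at position $i$ in the $\beta$-expansion of $x$ equals $a$. Let $X_\beta=\{X_{\beta,a}\mid a\in\tilde A_\beta\}$. A set $X\subseteq\mathbb R^n$ is $\beta$-definable if it is defined by a first-order formula (without parameters) in the structure $\langle\mathbb R,1,\le,+,X_\beta\rangle$. **Theorem.** Let $\beta>1$ be a Parry number and let $n\ge1$. If $X\subseteq\mathbb R^n$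 is $\beta$-recognizable, then $X$ is $\beta$-definable. -/

import Mathlib

open FirstOrder Filter

namespace BetaNumeration

/-! ### Parry numbers -/

/-- The infinite word `w = w₀ w₁ w₂ ⋯` is over the canonical alphabet `{0, …, ⌈β⌉ - 1}`, does not
end in `0^ω`, and `0 ⋆ w` is a `β`-representation of `1`. -/
structure IsInfiniteRepOfOne (β : ℝ) (w : ℕ → ℤ) : Prop where
  digit : ∀ i, 0 ≤ w i ∧ w i ≤ ⌈β⌉ - 1
  not_finite : ¬ ∃ N, ∀ i, N ≤ i → w i = 0
  hasSum : HasSum (fun i : ℕ => (w i : ℝ) * β ^ (-(i : ℤ) - 1)) 1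

/-- `w` is the Rényi expansion of `1`: the lexicographically greatest infinite representation. -/
def IsRenyiExpansion (β : ℝ) (w : ℕ → ℤ) : Prop :=
  IsInfiniteRepOfOne β w ∧ ∀ w', IsInfiniteRepOfOne β w' → toLex w' ≤ toLex w

/-- The Rényi expansion of `1` is ultimately periodic. -/
def IsParry (β : ℝ) : Prop :=
  ∃ w, IsRenyiExpansion β w ∧ ∃ N p : ℕ, 0 < p ∧ ∀ i, N ≤ i → w (i + p) = w i

/-! ### `β`-expansions

A word `u_k ⋯ u_0 ⋆ u_{-1} u_{-2} ⋯` is given by `k : ℕ` and `u : ℤ → ℤ`, where `u` is extended by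
`0` to the positions above `k`. -/

/-- The word `u_k ⋯ u_0 ⋆ u_{-1} u_{-2} ⋯` over the canonical alphabet `{0, …, ⌈β⌉ - 1}` has value
`x` and satisfies the greedy condition. -/
structure IsGreedyWord (β x : ℝ) (k : ℕ) (u : ℤ → ℤ) : Prop where
  zero_above : ∀ i : ℤ, (k : ℤ) < i → u i = 0
  digit : ∀ i : ℤ, i ≤ k → 0 ≤ u i ∧ u i ≤ ⌈β⌉ - 1
  hasSum : HasSum (fun j : ℕ => (u ((k : ℤ) - j) : ℝ) * β ^ ((k : ℤ) - j)) x
  greedy : ∀ l : ℤ, l ≤ k → ∑' j : ℕ, (u (l - j) : ℝ) * β ^ (l - (j : ℤ)) < β ^ (l + 1)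

/-- The `β`-expansion of a nonnegative real `x`: `k ≥ 0` is chosen minimal. -/
def IsNonnegExpansion (β x : ℝ) (k : ℕ) (u : ℤ → ℤ) : Prop :=
  IsGreedyWord β x k u ∧ ∀ k' u', IsGreedyWord β x k' u' → k ≤ k'

/-- `u_k ⋯ u_0 ⋆ u_{-1} u_{-2} ⋯` is the `β`-expansion `d_β(x)` of the real number `x`; for
`x < 0` it is the digitwise opposite of `d_β(-x)`. -/
def IsExpansion (β x : ℝ) (k : ℕ) (u : ℤ → ℤ) : Prop :=
  (0 ≤ x ∧ IsNonnegExpansion β x k u) ∨ (x < 0 ∧ IsNonnegExpansion β (-x) k (-u))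

/-- The components of the `β`-expansion of a point of `ℝⁿ`: the `β`-expansions of the coordinates
are padded with leading zeroes so that each has `K + 1` letters before `⋆`; the resulting word does
not start with `(0, …, 0)`, except if `|x i| < 1` for all `i`, in which case it starts with
`(0, …, 0) ⋆`. -/
def IsVecExpansion {n : ℕ} (β : ℝ) (x : Fin n → ℝ) (K : ℕ) (u : Fin n → ℤ → ℤ) : Prop :=
  (∀ i, ∃ k, k ≤ K ∧ IsExpansion β (x i) k (u i)) ∧
    ((∀ i, |x i| < 1) → K = 0) ∧ (¬ (∀ i, |x i| < 1) → ∃ i, u i K ≠ 0)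

/-! ### Words, Büchi automata and recognizable sets -/

/-- The alphabet `{-(⌈β⌉ - 1), …, ⌈β⌉ - 1}`. -/
abbrev Digit (β : ℝ) : Type := {a : ℤ // |a| ≤ ⌈β⌉ - 1}

/-- The alphabet of `n`-tuples of digits together with the separator `⋆`, which is `none`. -/
abbrev Letter (β : ℝ) (n : ℕ) : Type := Option (Fin n → Digit β)

/-- The infinite word with the letters `(u · K), …, (u · 0), ⋆, (u · (-1)), (u · (-2)), …`. -/
def syncWord {n : ℕ} (K : ℕ) (u : Fin n → ℤ → ℤ) (j : ℕ) : Option (Fin n → ℤ) :=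
  if j ≤ K then some fun i => u i ((K : ℤ) - j)
  else if j = K + 1 then none
  else some fun i => u i ((K : ℤ) + 1 - j)

/-- The language `d_β(X)` of the `β`-expansions of the points of `X`. -/
def expansionLanguage {n : ℕ} (β : ℝ) (X : Set (Fin n → ℝ)) : Set (ℕ → Letter β n) :=
  {w | ∃ x ∈ X, ∃ K u, IsVecExpansion β x K u ∧
    ∀ j, (w j).map (fun a i => (a i : ℤ)) = syncWord K u j}

/-- The language of infinite words accepted by `M`, considered as a Büchi automaton: there is an
infinite path with the given label that starts in an initial state and visits the set of terminal
states infinitely often. -/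
def buchiLanguage {α σ : Type*} (M : NFA α σ) : Set (ℕ → α) :=
  {w | ∃ r : ℕ → σ, r 0 ∈ M.start ∧ (∀ j, r (j + 1) ∈ M.step (r j) (w j)) ∧
    ∃ᶠ j in atTop, r j ∈ M.accept}

/-- `X` is `β`-recognizable. -/
def Recognizable {n : ℕ} (β : ℝ) (X : Set (Fin n → ℝ)) : Prop :=
  ∃ (Q : Type) (_ : Finite Q) (M : NFA (Letter β n) Q), buchiLanguage M = expansionLanguage β X

/-! ### Definable sets -/

/-- The predicate `X_{β,a}(x, y)`: `y` is an integral power `β ^ i` of `β`, and either `|x| < y` and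
`a = 0`, or `|x| ≥ y` and `a` is the digit of the `β`-expansion of `x` at position `i`. -/
def DigitPred (β : ℝ) (a : Digit β) (x y : ℝ) : Prop :=
  ∃ i : ℤ, y = β ^ i ∧
    ((|x| < y ∧ (a : ℤ) = 0) ∨
      (y ≤ |x| ∧ ∃ k u, IsExpansion β x k u ∧ i ≤ k ∧ u i = (a : ℤ)))

/-- Function symbols: the constant `1` and the addition. -/
inductive BetaFunc : ℕ → Type
  | one : BetaFunc 0
  | add : BetaFunc 2

/-- Relation symbols: the order and one binary predicate for each digit. -/
inductive BetaRel (β : ℝ) : ℕ → Type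
  | le : BetaRel β 2
  | digit (a : Digit β) : BetaRel β 2

/-- The first-order language with the symbols `1`, `≤`, `+` and `X_{β,a}`. -/
def betaLanguage (β : ℝ) : Language := ⟨BetaFunc, BetaRel β⟩

/-- The structure `⟨ℝ, 1, ≤, +, X_β⟩`. -/
noncomputable instance betaStructure (β : ℝ) : (betaLanguage β).Structure ℝ where
  funMap {_} f v :=
    match f, v with
    | BetaFunc.one, _ => 1
    | BetaFunc.add, v => v 0 + v 1
  RelMap {_} R v :=
    match R, v with
    | BetaRel.le, v => v 0 ≤ v 1
    | BetaRel.digit a, v => DigitPred β a (v 0) (v 1)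

/-- `X` is `β`-definable: it is defined by a first-order formula, without parameters, in the
structure `⟨ℝ, 1, ≤, +, X_β⟩`. -/
def BetaDefinable {n : ℕ} (β : ℝ) (X : Set (Fin n → ℝ)) : Prop :=
  (∅ : Set ℝ).Definable (betaLanguage β) X

end BetaNumeration

namespace BetaNumeration

/-! A point lies in `X` exactly when the automaton has an accepting run on its expansion, so it
suffices to express "there is an accepting run" by a first-order formula. A position `i` is
represented by the real `β ^ i`: order of positions is order of reals, position `0` is the constant
`1`, successor is definable by discreteness, and `X_{β,a}` reads digits. What remains is to quantify
over runs, that is, over colorings of the positions by states, using only finitely many real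
variables.

A subset of the positions would naturally be coded by the real whose digits are its indicator, but
an arbitrary 0-1 word need not be greedy. It is greedy when its ones are far apart: if `β ^ (-m) < 1
- β⁻¹`, then ones at distance at least `m` have tails below `(1 - β ^ (-m))⁻¹ * β ^ l < β ^ (l + 1)`
(`exists_digit_eq_of_sparse`). Splitting the positions into residue classes mod `m` therefore
encodes any coloring by `m * |Q|` reals (`exists_encoding`). Conversely, any reals whose digits
satisfy the run conditions describe a genuine run (`expansionWord_mem_buchiLanguage_iff`). These
conditions are local or of the form "below every position", and are first-order by the closure
properties of `MixedDefinable`. -/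

/-! ### Greedy words -/

/-- The value `∑_{i ≤ l} u_i β ^ i` of the tail of a word. -/
noncomputable def tail (β : ℝ) (u : ℤ → ℤ) (l : ℤ) : ℝ :=
  ∑' j : ℕ, (u (l - j) : ℝ) * β ^ (l - (j : ℤ))

theorem summable_tail_sub_one_iff (β : ℝ) (u : ℤ → ℤ) (l : ℤ) :
    (Summable fun j : ℕ => (u (l - 1 - j) : ℝ) * β ^ (l - 1 - (j : ℤ))) ↔
      Summable fun j : ℕ => (u (l - j) : ℝ) * β ^ (l - (j : ℤ)) := by
  rw [← summable_nat_add_iff (f := fun j : ℕ => (u (l - j) : ℝ) * β ^ (l - (j : ℤ))) 1]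
  have (j : ℕ) : l - 1 - (j : ℤ) = l - ((j + 1 : ℕ) : ℤ) := by push_cast; ring
  simp only [this]

theorem tail_eq_add {β : ℝ} {u : ℤ → ℤ} {l : ℤ}
    (h : Summable fun j : ℕ => (u (l - j) : ℝ) * β ^ (l - (j : ℤ))) :
    tail β u l = u l * β ^ l + tail β u (l - 1) := by
  have (j : ℕ) : l - 1 - (j : ℤ) = l - ((j + 1 : ℕ) : ℤ) := by push_cast; ring
  rw [tail, h.tsum_eq_zero_add, tail]
  simp only [this]
  simp

namespace IsGreedyWord

variable {β x : ℝ} {k : ℕ} {u : ℤ → ℤ}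

theorem summable (h : IsGreedyWord β x k u) (l : ℤ) :
    Summable fun j : ℕ => (u (l - j) : ℝ) * β ^ (l - (j : ℤ)) := by
  induction l using Int.inductionOn' (b := (k : ℤ)) with
  | zero => exact h.hasSum.summable
  | succ l _ ih => rw [← summable_tail_sub_one_iff]; simpa using ih
  | pred l _ ih => rwa [summable_tail_sub_one_iff]

theorem nonneg (h : IsGreedyWord β x k u) (i : ℤ) : 0 ≤ u i := by
  rcases le_or_gt i k with hi | hi
  · exact (h.digit i hi).1
  · rw [h.zero_above i hi]

theorem tail_eq (h : IsGreedyWord β x k u) (l : ℤ) :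
    tail β u l = u l * β ^ l + tail β u (l - 1) :=
  tail_eq_add (h.summable l)

theorem tail_nonneg (hβ : 1 < β) (h : IsGreedyWord β x k u) (l : ℤ) : 0 ≤ tail β u l :=
  tsum_nonneg fun j => mul_nonneg (by exact_mod_cast h.nonneg _)
    (zpow_nonneg (by linarith) _)

theorem tail_eq_of_zero_above (h : IsGreedyWord β x k u) {m l : ℤ}
    (hm : ∀ i, m < i → u i = 0) (hl : m ≤ l) : tail β u l = tail β u m := by
  induction l, hl using Int.leInduction with
  | base => rfl
  | succ l hl ih => rw [h.tail_eq, hm _ (by omega)]; simpa using ih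

theorem tail_eq_of_le (h : IsGreedyWord β x k u) {l : ℤ} (hl : k ≤ l) : tail β u l = x := by
  rw [h.tail_eq_of_zero_above h.zero_above hl]
  exact h.hasSum.tsum_eq

theorem tail_lt (hβ : 1 < β) (h : IsGreedyWord β x k u) (l : ℤ) :
    tail β u l < β ^ (l + 1) := by
  rcases le_or_gt l k with hl | hl
  · exact h.greedy l hl
  · rw [h.tail_eq_of_zero_above h.zero_above hl.le]
    exact (h.greedy k le_rfl).trans_le (zpow_le_zpow_right₀ hβ.le (by omega))

theorem tail_mono (hβ : 1 < β) (h : IsGreedyWord β x k u) : Monotone (tail β u) := by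
  refine monotone_int_of_le_succ fun l => ?_
  rw [h.tail_eq (l + 1), add_sub_cancel_right]
  have : (0 : ℝ) ≤ u (l + 1) * β ^ (l + 1) :=
    mul_nonneg (by exact_mod_cast h.nonneg _) (zpow_nonneg (by linarith) _)
  linarith

theorem eq_floor (hβ : 1 < β) (h : IsGreedyWord β x k u) (l : ℤ) :
    u l = ⌊tail β u l / β ^ l⌋ := by
  have hp : 0 < β ^ l := zpow_pos (by linarith) _
  have h1 := h.tail_lt hβ (l - 1)
  rw [sub_add_cancel] at h1
  have h0 := h.tail_nonneg hβ (l - 1)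
  symm
  rw [Int.floor_eq_iff, le_div_iff₀ hp, div_lt_iff₀ hp, h.tail_eq l]
  constructor <;> linarith

/-- The tail at `l` determines the digit at `l` by `eq_floor`, hence the tail at `l - 1`. Far to the
left both tails equal `x`, so a downward induction applies. -/
theorem unique (hβ : 1 < β) {k' : ℕ} {u' : ℤ → ℤ} (h : IsGreedyWord β x k u)
    (h' : IsGreedyWord β x k' u') : u = u' := by
  have key (l : ℤ) : tail β u l = tail β u' l := by
    rcases le_total (max k k' : ℤ) l with hl | hl
    · rw [h.tail_eq_of_le (by omega), h'.tail_eq_of_le (by omega)]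
    · induction l, hl using Int.leInductionDown with
      | base => rw [h.tail_eq_of_le (by omega), h'.tail_eq_of_le (by omega)]
      | pred l hl ih =>
        have e := h.tail_eq l
        have e' := h'.tail_eq l
        rw [h.eq_floor hβ] at e
        rw [h'.eq_floor hβ] at e'
        rw [← ih] at e'
        linarith
  funext l
  rw [h.eq_floor hβ, h'.eq_floor hβ, key]

theorem of_zero_above (hβ : 1 < β) (h : IsGreedyWord β x k u) {m : ℕ}
    (hm : ∀ i : ℤ, m < i → u i = 0) : IsGreedyWord β x m u where
  zero_above := hm
  digit i _ := by
    rcases le_or_gt i k with hi | hi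
    · exact h.digit i hi
    · have : 0 < ⌈β⌉ := Int.ceil_pos.2 (by linarith)
      rw [h.zero_above i hi]
      omega
  hasSum := by
    have e : tail β u m = x := by
      rw [← h.tail_eq_of_zero_above hm (le_max_left (m : ℤ) k), h.tail_eq_of_le (le_max_right _ _)]
    rw [← e]
    exact (h.summable m).hasSum
  greedy l _ := h.tail_lt hβ l

/-- A nonzero digit at `j ≥ l` alone contributes at least `β ^ l`; without one, `x` is the tail at
`l - 1`, which the greedy condition bounds. -/
theorem lt_zpow_iff (hβ : 1 < β) (h : IsGreedyWord β x k u) (l : ℤ) :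
    x < β ^ l ↔ ∀ j, l ≤ j → u j = 0 := by
  constructor
  · intro hx j hj
    by_contra hne
    have h1 : (1 : ℝ) ≤ u j := by
      have := h.nonneg j
      exact_mod_cast (by omega : 1 ≤ u j)
    have hp : β ^ l ≤ β ^ j := zpow_le_zpow_right₀ hβ.le hj
    have hp0 : 0 < β ^ j := zpow_pos (by linarith) _
    have ht : tail β u j ≤ x := by
      rw [← h.tail_eq_of_le (le_max_right j (k : ℤ))]
      exact h.tail_mono hβ (le_max_left _ _)
    rw [h.tail_eq] at ht
    nlinarith [h.tail_nonneg hβ (j - 1)]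
  · intro hz
    rw [← h.tail_eq_of_le (le_max_right (l - 1) (k : ℤ)),
      h.tail_eq_of_zero_above (m := l - 1) (fun i hi => hz i (by omega)) (le_max_left _ _)]
    simpa using h.tail_lt hβ (l - 1)

end IsGreedyWord

/-- The remainders of the greedy algorithm for `x`, starting at position `k`. -/
noncomputable def remainder (β x : ℝ) (k : ℤ) : ℕ → ℝ
  | 0 => x
  | j + 1 => remainder β x k j - ⌊remainder β x k j / β ^ (k - j)⌋ * β ^ (k - j)

theorem remainder_mem {β x : ℝ} (hβ : 1 < β) (hx : 0 ≤ x) {k : ℤ} (hk : x < β ^ (k + 1)) (j : ℕ) :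
    0 ≤ remainder β x k j ∧ remainder β x k j < β ^ (k + 1 - j) := by
  induction j with
  | zero => simpa [remainder] using ⟨hx, hk⟩
  | succ j ih =>
    have hp : 0 < β ^ (k - j) := zpow_pos (by linarith) _
    have h1 := Int.floor_le (remainder β x k j / β ^ (k - j))
    have h2 := Int.lt_floor_add_one (remainder β x k j / β ^ (k - j))
    rw [le_div_iff₀ hp] at h1
    rw [div_lt_iff₀ hp] at h2
    have e : k + 1 - ((j + 1 : ℕ) : ℤ) = k - j := by push_cast; ring
    rw [e, remainder]
    constructor <;> linarith

/-- The digits are the successive quotients of the greedy algorithm. The tail at each position is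
the remainder at that stage, so the greedy condition is precisely the bound in `remainder_mem`. -/
theorem exists_isGreedyWord {β x : ℝ} (hβ : 1 < β) (hx : 0 ≤ x) {k : ℕ} (hk : x < β ^ (k + 1)) :
    ∃ u, IsGreedyWord β x k u := by
  have hβ0 : 0 < β := by linarith
  have hk' : x < β ^ ((k : ℤ) + 1) := by exact_mod_cast hk
  set r := remainder β x k with hr
  have hmem := remainder_mem hβ hx hk'
  rw [← hr] at hmem
  let d : ℕ → ℤ := fun j => ⌊r j / β ^ ((k : ℤ) - j)⌋
  have hstep (j : ℕ) : r (j + 1) = r j - d j * β ^ ((k : ℤ) - j) := rfl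
  have hd (j : ℕ) : 0 ≤ d j ∧ d j ≤ ⌈β⌉ - 1 := by
    have hp : 0 < β ^ ((k : ℤ) - j) := zpow_pos hβ0 _
    refine ⟨Int.floor_nonneg.2 (div_nonneg (hmem j).1 hp.le), ?_⟩
    rw [Int.le_sub_one_iff, Int.floor_lt]
    refine lt_of_lt_of_le ?_ (Int.le_ceil β)
    rw [div_lt_iff₀ hp, ← zpow_one_add₀ hβ0.ne',
      show 1 + ((k : ℤ) - j) = k + 1 - j by ring]
    exact (hmem j).2
  have hlim : Tendsto r atTop (nhds 0) := by
    have hg : Tendsto (fun j : ℕ => β ^ (k + 1) * β⁻¹ ^ j) atTop (nhds 0) := by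
      simpa using (tendsto_pow_atTop_nhds_zero_of_lt_one (inv_nonneg.2 hβ0.le)
        (inv_lt_one_of_one_lt₀ hβ)).const_mul (β ^ (k + 1))
    refine squeeze_zero (fun j => (hmem j).1) (fun j => ?_) hg
    refine (hmem j).2.le.trans_eq ?_
    rw [zpow_sub₀ hβ0.ne', inv_pow, div_eq_mul_inv]
    norm_cast
  have hsum (m : ℕ) :
      HasSum (fun j : ℕ => (d (m + j) : ℝ) * β ^ ((k : ℤ) - (m + j : ℕ))) (r m) := by
    rw [hasSum_iff_tendsto_nat_of_nonneg]
    · have hpart (N : ℕ) : ∑ j ∈ Finset.range N, (d (m + j) : ℝ) * β ^ ((k : ℤ) - (m + j : ℕ)) =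
          r m - r (m + N) := by
        induction N with
        | zero => simp
        | succ N ih => rw [Finset.sum_range_succ, ih, ← add_assoc, hstep]; ring
      simp only [hpart]
      have : Tendsto (fun N => r (m + N)) atTop (nhds 0) := by
        simpa only [add_comm] using (tendsto_add_atTop_iff_nat m).2 hlim
      simpa using this.const_sub (r m)
    · exact fun j => mul_nonneg (by exact_mod_cast (hd _).1) (zpow_pos hβ0 _).le
  have htoNat (l : ℤ) (hl : l ≤ k) (j : ℕ) :
      (k - (l - j) : ℤ).toNat = (k - l).toNat + j := by omega
  refine ⟨fun i => if i ≤ k then d (k - i).toNat else 0, fun i hi => if_neg (by omega),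
    fun i hi => by simpa only [if_pos hi] using hd _, ?_, fun l hl => ?_⟩
  · convert hsum 0 using 3 with j
    · rw [if_pos (by omega), htoNat k le_rfl]
      simp
    · simp
    · rfl
  · have e : (fun j : ℕ => ((if l - (j : ℤ) ≤ k then d (k - (l - j)).toNat else 0 : ℤ) : ℝ) *
        β ^ (l - (j : ℤ))) =
        fun j : ℕ => (d ((k - l).toNat + j) : ℝ) * β ^ ((k : ℤ) - ((k - l).toNat + j : ℕ)) := by
      funext j
      rw [if_pos (by omega), htoNat l hl]
      congr 2
      omega
    rw [e, (hsum _).tsum_eq]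
    convert (hmem _).2 using 2
    omega

/-! ### The digits of a real number -/

theorem IsExpansion.unique {β x : ℝ} (hβ : 1 < β) {k k' : ℕ} {u u' : ℤ → ℤ}
    (h : IsExpansion β x k u) (h' : IsExpansion β x k' u') : u = u' := by
  rcases h with ⟨hx, h, -⟩ | ⟨hx, h, -⟩ <;> rcases h' with ⟨hx', h', -⟩ | ⟨hx', h', -⟩
  · exact h.unique hβ h'
  · linarith
  · linarith
  · exact neg_injective (h.unique hβ h')

theorem exists_isNonnegExpansion {β x : ℝ} (hβ : 1 < β) (hx : 0 ≤ x) :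
    ∃ u k, IsNonnegExpansion β x k u := by
  classical
  have hex : ∃ k : ℕ, ∃ u, IsGreedyWord β x k u := by
    obtain ⟨k, hk⟩ := pow_unbounded_of_one_lt x hβ
    exact ⟨k, exists_isGreedyWord hβ hx (hk.trans (pow_lt_pow_right₀ hβ k.lt_succ_self))⟩
  obtain ⟨u, hu⟩ := Nat.find_spec hex
  exact ⟨u, _, hu, fun k' u' h' => Nat.find_min' hex ⟨u', h'⟩⟩

theorem exists_isExpansion {β : ℝ} (hβ : 1 < β) (x : ℝ) : ∃ u k, IsExpansion β x k u := by
  rcases le_or_gt 0 x with hx | hx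
  · obtain ⟨u, k, h⟩ := exists_isNonnegExpansion hβ hx
    exact ⟨u, k, Or.inl ⟨hx, h⟩⟩
  · obtain ⟨u, k, h⟩ := exists_isNonnegExpansion hβ (neg_nonneg.2 hx.le)
    exact ⟨-u, k, Or.inr ⟨hx, by rwa [neg_neg]⟩⟩

theorem IsExpansion.greedy_abs {β x : ℝ} {k : ℕ} {u : ℤ → ℤ} (h : IsExpansion β x k u) :
    IsNonnegExpansion β |x| k |u| := by
  rcases h with ⟨hx, h⟩ | ⟨hx, h⟩
  · rwa [abs_of_nonneg hx, abs_of_nonneg (fun i => h.1.nonneg i)]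
  · rwa [abs_of_neg hx, ← abs_neg u, abs_of_nonneg (fun i => h.1.nonneg i)]

theorem IsExpansion.hasSum {β x : ℝ} (hβ : 1 < β) {k : ℕ} {u : ℤ → ℤ} (h : IsExpansion β x k u)
    {m : ℕ} (hm : k ≤ m) : HasSum (fun j : ℕ => (u ((m : ℤ) - j) : ℝ) * β ^ ((m : ℤ) - j)) x := by
  rcases h with ⟨-, h, -⟩ | ⟨-, h, -⟩
  · exact (h.of_zero_above hβ fun i hi => h.zero_above i (by omega)).hasSum
  · have := (h.of_zero_above (m := m) hβ fun i hi => h.zero_above i (by omega)).hasSum.neg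
    simpa using this

/-- The digits of the `β`-expansion of `x`, extended by zero above the leading position. -/
noncomputable def digit (β x : ℝ) : ℤ → ℤ :=
  Classical.epsilon fun u => ∃ k, IsExpansion β x k u

theorem exists_isExpansion_digit {β : ℝ} (hβ : 1 < β) (x : ℝ) :
    ∃ k, IsExpansion β x k (digit β x) :=
  Classical.epsilon_spec (exists_isExpansion hβ x)

theorem IsExpansion.eq_digit {β x : ℝ} (hβ : 1 < β) {k : ℕ} {u : ℤ → ℤ}
    (h : IsExpansion β x k u) : u = digit β x :=
  let ⟨_, h'⟩ := exists_isExpansion_digit hβ x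
  h.unique hβ h'

theorem IsGreedyWord.eq_digit {β x : ℝ} (hβ : 1 < β) {k : ℕ} {u : ℤ → ℤ}
    (h : IsGreedyWord β x k u) : u = BetaNumeration.digit β x := by
  have hx : 0 ≤ x := by
    rw [← h.tail_eq_of_le le_rfl]
    exact h.tail_nonneg hβ k
  obtain ⟨k', h' | h'⟩ := exists_isExpansion_digit hβ x
  · exact h.unique hβ h'.2.1
  · linarith [h'.1]

theorem abs_digit_le {β : ℝ} (hβ : 1 < β) (x : ℝ) (i : ℤ) : |digit β x i| ≤ ⌈β⌉ - 1 := by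
  obtain ⟨k, h⟩ := exists_isExpansion_digit hβ x
  have h := h.greedy_abs.1.of_zero_above hβ (m := max k i.toNat)
    fun i hi => h.greedy_abs.1.zero_above i (by omega)
  exact (h.digit i (by omega)).2

theorem abs_lt_zpow_iff {β : ℝ} (hβ : 1 < β) (x : ℝ) (l : ℤ) :
    |x| < β ^ l ↔ ∀ j, l ≤ j → digit β x j = 0 := by
  obtain ⟨k, h⟩ := exists_isExpansion_digit hβ x
  rw [h.greedy_abs.1.lt_zpow_iff hβ]
  simp

/-- The two clauses of the predicate merge, because the digits of `x` vanish from position `i` on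
when `|x| < β ^ i`. -/
theorem digitPred_zpow_iff {β : ℝ} (hβ : 1 < β) (a : Digit β) (x : ℝ) (i : ℤ) :
    DigitPred β a x (β ^ i) ↔ digit β x i = a := by
  constructor
  · rintro ⟨j, hj, h⟩
    obtain rfl : i = j := zpow_right_injective₀ (by linarith) hβ.ne' hj
    rcases h with ⟨hx, ha⟩ | ⟨-, k, u, hu, -, ha⟩
    · rw [ha, (abs_lt_zpow_iff hβ x i).1 hx i le_rfl]
    · rw [← hu.eq_digit hβ, ha]
  · intro ha
    refine ⟨i, rfl, ?_⟩
    rcases lt_or_ge |x| (β ^ i) with hx | hx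
    · exact Or.inl ⟨hx, by rw [← ha, (abs_lt_zpow_iff hβ x i).1 hx i le_rfl]⟩
    · obtain ⟨k, h⟩ := exists_isExpansion_digit hβ x
      refine Or.inr ⟨hx, k, _, h, ?_, ha⟩
      by_contra! hk
      refine hx.not_gt ((abs_lt_zpow_iff hβ x i).2 fun j hj => ?_)
      simpa using h.greedy_abs.1.zero_above j (by omega)

/-- `k` is the position of the leading letter of the `β`-expansion of the point `x`. -/
def IsLeading {n : ℕ} (β : ℝ) (x : Fin n → ℝ) (k : ℤ) : Prop :=
  0 ≤ k ∧ (∀ i j, k < j → digit β (x i) j = 0) ∧ (k = 0 ∨ ∃ i, digit β (x i) k ≠ 0)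

theorem isVecExpansion_iff {n : ℕ} {β : ℝ} (hβ : 1 < β) (x : Fin n → ℝ) (K : ℕ)
    (u : Fin n → ℤ → ℤ) :
    IsVecExpansion β x K u ↔ IsLeading β x K ∧ u = fun i => digit β (x i) := by
  have hlt (y : ℝ) : |y| < 1 ↔ ∀ j, 0 ≤ j → digit β y j = 0 := by
    rw [← abs_lt_zpow_iff hβ y 0, zpow_zero]
  constructor
  · rintro ⟨h, h0, h1⟩
    obtain rfl : u = fun i => digit β (x i) := by
      funext i
      obtain ⟨k, -, hk⟩ := h i
      exact hk.eq_digit hβ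
    refine ⟨⟨by omega, fun i j hj => ?_, ?_⟩, rfl⟩
    · obtain ⟨k, hkK, hk⟩ := h i
      simpa using hk.greedy_abs.1.zero_above j (by omega)
    · by_cases hx : ∀ i, |x i| < 1
      · exact Or.inl (by exact_mod_cast h0 hx)
      · exact Or.inr (h1 hx)
  · rintro ⟨⟨-, h, h0⟩, rfl⟩
    refine ⟨fun i => ?_, fun hx => ?_, fun hx => ?_⟩
    · obtain ⟨k, hk⟩ := exists_isExpansion_digit hβ (x i)
      refine ⟨k, hk.greedy_abs.2 K _ (hk.greedy_abs.1.of_zero_above hβ fun j hj => ?_), hk⟩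
      simpa using h i j hj
    · rcases h0 with h0 | ⟨i, hi⟩
      · exact_mod_cast h0
      · exact absurd ((hlt _).1 (hx i) K (by omega)) hi
    · rcases h0 with h0 | h0
      · by_contra! hz
        refine hx fun i => (hlt _).2 fun j hj => ?_
        rcases eq_or_lt_of_le hj with rfl | hj
        · simpa only [h0] using hz i
        · exact h i j (by omega)
      · exact h0

/-! ### Sparse words -/

/-- The parameter `d` records how many leading digits are already known to vanish. Reading a one
resets it to `m - 1`, and `hC'` absorbs that one: `β ^ l + C * β ^ (l - m) ≤ C * β ^ l`. -/
theorem sum_sparse_le {β C : ℝ} (hβ : 1 < β) {m : ℕ} (hm : 1 ≤ m) {u : ℤ → ℤ}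
    (hu : ∀ i, u i = 0 ∨ u i = 1)
    (hsp : ∀ i j, u i = 1 → i - m < j → j < i → u j = 0) (hC : 0 ≤ C)
    (hC' : 1 + C * β ^ (-(m : ℤ)) ≤ C) (N : ℕ) : ∀ (l : ℤ) (d : ℕ),
      d < m → (∀ j, l - d < j → j ≤ l → u j = 0) →
      ∑ j ∈ Finset.range N, (u (l - j) : ℝ) * β ^ (l - (j : ℤ)) ≤ C * β ^ (l - d) := by
  have hβ0 : 0 < β := by linarith
  induction N with
  | zero => intro l d _ _; simpa using mul_nonneg hC (zpow_nonneg hβ0.le _)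
  | succ N ih =>
    intro l d hd hz
    have e (j : ℕ) : l - ((j + 1 : ℕ) : ℤ) = l - 1 - j := by push_cast; ring
    rw [Finset.sum_range_succ']
    simp only [e]
    rw [Nat.cast_zero, sub_zero]
    rcases d with - | d
    · rcases hu l with hl | hl
      · have h1 := ih (l - 1) 0 (by omega) (fun j _ _ => by omega)
        have h2 : β ^ (l - 1) ≤ β ^ l := zpow_le_zpow_right₀ hβ.le (by omega)
        have h3 := mul_le_mul_of_nonneg_left h2 hC
        simp only [hl, Nat.cast_zero, sub_zero, Int.cast_zero, zero_mul, add_zero] at h1 ⊢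
        linarith
      · have h1 := ih (l - 1) (m - 1) (by omega) (fun j _ _ => hsp l j hl (by omega) (by omega))
        have h2 : β ^ (l - 1 - ((m - 1 : ℕ) : ℤ)) = β ^ (-(m : ℤ)) * β ^ l := by
          rw [← zpow_add₀ hβ0.ne']
          congr 1
          omega
        have h3 := mul_le_mul_of_nonneg_right hC' (zpow_nonneg hβ0.le l)
        rw [h2] at h1
        simp only [hl, Nat.cast_zero, sub_zero, Int.cast_one, one_mul]
        linarith
    · have h1 := ih (l - 1) d (by omega) (fun j _ _ => hz j (by omega) (by omega))
      rw [hz l (by omega) le_rfl]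
      rw [show l - 1 - (d : ℤ) = l - ((d + 1 : ℕ) : ℤ) by push_cast; ring] at h1
      simpa using h1

theorem exists_digit_eq_of_sparse {β : ℝ} (hβ : 1 < β) : ∃ m : ℕ, 1 ≤ m ∧
    ∀ (K : ℕ) (u : ℤ → ℤ), (∀ i, u i = 0 ∨ u i = 1) → (∀ i : ℤ, K < i → u i = 0) →
      (∀ i j, u i = 1 → i - m < j → j < i → u j = 0) → ∃ x, digit β x = u := by
  have hβ0 : 0 < β := by linarith
  -- This inequality says `(1 - β ^ (-m))⁻¹ < β`: the geometric series of ones at distance `m` stays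
  -- below the next power of `β`.
  obtain ⟨m, hm⟩ := exists_pow_lt_of_lt_one (sub_pos.2 (inv_lt_one_of_one_lt₀ hβ))
    (inv_lt_one_of_one_lt₀ hβ)
  have hm1 : 1 ≤ m := by
    rcases m with - | m
    · have := inv_pos.2 hβ0
      simp only [pow_zero] at hm
      linarith
    · omega
  refine ⟨m, hm1, fun K u hu hK hsp => ?_⟩
  set q := β ^ (-(m : ℤ)) with hq
  have hqe : q = β⁻¹ ^ m := by rw [hq, zpow_neg, zpow_natCast, inv_pow]
  have hq0 : 0 < q := zpow_pos hβ0 _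
  have hinv := inv_pos.2 hβ0
  have h1q : 0 < 1 - q := by rw [hqe]; linarith
  have hCβ : (1 - q)⁻¹ < β := by
    rw [inv_lt_comm₀ h1q hβ0]
    linarith
  have hC : 1 + (1 - q)⁻¹ * q ≤ (1 - q)⁻¹ := by
    have := inv_mul_cancel₀ h1q.ne'
    linarith
  have hnn (l : ℤ) (j : ℕ) : 0 ≤ (u (l - j) : ℝ) * β ^ (l - (j : ℤ)) :=
    mul_nonneg (by rcases hu (l - j) with h | h <;> simp [h]) (zpow_nonneg hβ0.le _)
  have hb (l : ℤ) (N : ℕ) :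
      ∑ j ∈ Finset.range N, (u (l - j) : ℝ) * β ^ (l - (j : ℤ)) ≤ (1 - q)⁻¹ * β ^ l := by
    simpa using sum_sparse_le hβ hm1 hu hsp (inv_pos.2 h1q).le hC N l 0 (by omega)
      (fun j _ _ => by omega)
  have hsum (l : ℤ) := summable_of_sum_range_le (hnn l) (hb l)
  have hg : IsGreedyWord β (tail β u K) K u := by
    refine ⟨hK, fun i _ => ?_, (hsum K).hasSum, fun l _ => ?_⟩
    · have : 1 < ⌈β⌉ := Int.lt_ceil.2 (by simpa using hβ)
      rcases hu i with h | h <;> omega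
    · refine (Real.tsum_le_of_sum_range_le (hnn l) (hb l)).trans_lt ?_
      rw [zpow_add_one₀ hβ0.ne', mul_comm]
      exact mul_lt_mul_of_pos_left hCβ (zpow_pos hβ0 _)
  exact ⟨_, (hg.eq_digit hβ).symm⟩

/-- Every coloring of the positions up to `K` by elements of `Q` is encoded by finitely many reals:
the position `i` has color `q` if and only if the digit at `i` of one of the reals `y (r, q)` is
`1`. -/
theorem exists_encoding {β : ℝ} (hβ : 1 < β) : ∃ m : ℕ, ∀ (Q : Type) (s : ℤ → Q) (K : ℕ),
    ∃ y : Fin m × Q → ℝ, ∀ i ≤ (K : ℤ), ∀ q, (∃ r, digit β (y (r, q)) i = 1) ↔ s i = q := by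
  classical
  obtain ⟨m, hm, h⟩ := exists_digit_eq_of_sparse hβ
  refine ⟨m, fun Q s K => ?_⟩
  -- The word for `(r, q)` marks the positions of color `q` in the residue class `r`; two marked
  -- positions differ by a multiple of `m`, so the word is sparse.
  let u (c : Fin m × Q) (i : ℤ) : ℤ := if i ≤ K ∧ s i = c.2 ∧ i % m = (c.1 : ℕ) then 1 else 0
  have hu (c : Fin m × Q) (i : ℤ) : u c i = 1 ↔ i ≤ K ∧ s i = c.2 ∧ i % m = (c.1 : ℕ) := by
    simp [u]
  have hu0 (c : Fin m × Q) (i : ℤ) : u c i = 0 ↔ ¬ (i ≤ K ∧ s i = c.2 ∧ i % m = (c.1 : ℕ)) := by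
    simp [u]
  have hex (c : Fin m × Q) : ∃ x, digit β x = u c := by
    refine h K (u c) (fun i => ?_) (fun i hi => ?_) (fun i j hi hij hji => ?_)
    · rw [hu, hu0]; tauto
    · rw [hu0]; omega
    · rw [hu] at hi
      rw [hu0]
      rintro ⟨-, -, hj⟩
      have hdvd : (m : ℤ) ∣ i - j := Int.ModEq.dvd (hj.trans hi.2.2.symm)
      have := Int.le_of_dvd (by omega) hdvd
      omega
  choose y hy using hex
  refine ⟨y, fun i hi q => ?_⟩
  simp only [hy, hu]
  constructor
  · rintro ⟨r, -, hr, -⟩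
    exact hr
  · intro hs
    have h0 := Int.emod_nonneg i (by omega : (m : ℤ) ≠ 0)
    have h1 := Int.emod_lt_of_pos i (by omega : (0 : ℤ) < m)
    exact ⟨⟨(i % m).toNat, by omega⟩, hi, hs, by simp [h0]⟩

/-! ### Definability with variables for reals and for integers -/

instance (β : ℝ) : Finite (Digit β) :=
  ((Set.finite_Icc (-(⌈β⌉ - 1)) (⌈β⌉ - 1)).subset fun _ ha => abs_le.1 ha).to_subtype

theorem definable_setOf_le (β : ℝ) {α : Type} (a b : α) :
    (∅ : Set ℝ).Definable (betaLanguage β) {v : α → ℝ | v a ≤ v b} := by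
  refine Set.empty_definable_iff.2 ⟨Language.Relations.formula₂
    (BetaRel.le : (betaLanguage β).Relations 2) (Language.Term.var a) (Language.Term.var b), ?_⟩
  ext v
  simp only [Set.mem_ofPred_eq]
  rfl

theorem definable_setOf_digitPred (β : ℝ) {α : Type} (d : Digit β) (a b : α) :
    (∅ : Set ℝ).Definable (betaLanguage β) {v : α → ℝ | DigitPred β d (v a) (v b)} := by
  refine Set.empty_definable_iff.2 ⟨Language.Relations.formula₂
    (BetaRel.digit d : (betaLanguage β).Relations 2) (Language.Term.var a)
    (Language.Term.var b), ?_⟩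
  ext v
  simp only [Set.mem_ofPred_eq]
  rfl

theorem definable_setOf_eq_one (β : ℝ) {α : Type} (a : α) :
    (∅ : Set ℝ).Definable (betaLanguage β) {v : α → ℝ | v a = 1} := by
  refine Set.empty_definable_iff.2 ⟨Language.Term.equal (Language.Term.var a)
    (Language.Constants.term (BetaFunc.one : (betaLanguage β).Constants)), ?_⟩
  ext v
  simp only [Set.mem_ofPred_eq, Language.Formula.realize_equal, Language.Term.realize_var]
  rfl

/-- The second argument of a digit predicate is always a power of `β`, and a power of `β` is related
to itself by the predicate of its own digit. -/
theorem definable_setOf_zpow {β : ℝ} (hβ : 1 < β) {α : Type} (a : α) :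
    (∅ : Set ℝ).Definable (betaLanguage β) {v : α → ℝ | ∃ i : ℤ, v a = β ^ i} := by
  convert! Set.definable_iUnion_of_finite fun d : Digit β => definable_setOf_digitPred β d a a
    using 1
  ext v
  simp only [Set.mem_iUnion, Set.mem_ofPred_eq]
  constructor
  · rintro ⟨i, hi⟩
    have h := (digitPred_zpow_iff hβ ⟨digit β (v a) i, abs_digit_le hβ _ _⟩ (v a) i).2 rfl
    rw [← hi] at h
    exact ⟨_, h⟩
  · rintro ⟨d, i, hi, -⟩
    exact ⟨i, hi⟩

/-- `P` is a definable predicate in real variables `v a` and integer variables `e c`, where the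
integer `i` is represented by the real number `β ^ i`. -/
def MixedDefinable (β : ℝ) {α κ : Type} (P : (α → ℝ) → (κ → ℤ) → Prop) : Prop :=
  (∅ : Set ℝ).Definable (betaLanguage β)
    {v : α ⊕ κ → ℝ | ∃ e : κ → ℤ, (∀ c, v (Sum.inr c) = β ^ e c) ∧ P (fun a => v (Sum.inl a)) e}

namespace MixedDefinable

variable {β : ℝ} {α κ γ : Type} {P R : (α → ℝ) → (κ → ℤ) → Prop}

theorem exponents_unique (hβ : 1 < β) {v : α ⊕ κ → ℝ} {e e' : κ → ℤ}
    (h : ∀ c, v (Sum.inr c) = β ^ e c) (h' : ∀ c, v (Sum.inr c) = β ^ e' c) : e = e' :=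
  funext fun c => zpow_right_injective₀ (by linarith) hβ.ne' ((h c).symm.trans (h' c))

/-- Being a power of `β` is definable and determines the exponent, so a formula only has to be
correct on valuations whose integer coordinates are powers. -/
theorem of_definable [Finite κ] (hβ : 1 < β) {S : Set (α ⊕ κ → ℝ)}
    (hS : (∅ : Set ℝ).Definable (betaLanguage β) S)
    (h : ∀ v e, (∀ c, v (Sum.inr c) = β ^ e c) → (P (fun a => v (Sum.inl a)) e ↔ v ∈ S)) :
    MixedDefinable β P := by
  unfold MixedDefinable
  convert! (Set.definable_iInter_of_finite fun c : κ =>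
    definable_setOf_zpow hβ (Sum.inr c : α ⊕ κ)).inter hS using 1
  ext v
  simp only [Set.mem_inter_iff, Set.mem_iInter, Set.mem_ofPred_eq]
  constructor
  · rintro ⟨e, he, hP⟩
    exact ⟨fun c => ⟨_, he c⟩, (h v e he).1 hP⟩
  · rintro ⟨he, hv⟩
    choose e he using he
    exact ⟨e, he, (h v e he).2 hv⟩

theorem not [Finite κ] (hβ : 1 < β) (hP : MixedDefinable β P) :
    MixedDefinable β fun v e => ¬ P v e := by
  refine of_definable hβ (Set.Definable.compl hP) fun v e he => not_congr ⟨fun h => ⟨e, he, h⟩, ?_⟩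
  rintro ⟨e', he', h⟩
  rwa [exponents_unique hβ he he']

theorem and [Finite κ] (hβ : 1 < β) (hP : MixedDefinable β P) (hR : MixedDefinable β R) :
    MixedDefinable β fun v e => P v e ∧ R v e := by
  refine of_definable hβ (Set.Definable.inter hP hR) fun v e he =>
    ⟨fun h => ⟨⟨e, he, h.1⟩, ⟨e, he, h.2⟩⟩, ?_⟩
  rintro ⟨⟨e', he', h⟩, ⟨e'', he'', h'⟩⟩
  rw [← exponents_unique hβ he he'] at h
  rw [← exponents_unique hβ he he''] at h'
  exact ⟨h, h'⟩

theorem or [Finite κ] (hβ : 1 < β) (hP : MixedDefinable β P) (hR : MixedDefinable β R) :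
    MixedDefinable β fun v e => P v e ∨ R v e := by
  convert! ((hP.not hβ).and hβ (hR.not hβ)).not hβ using 3
  tauto

theorem imp [Finite κ] (hβ : 1 < β) (hP : MixedDefinable β P) (hR : MixedDefinable β R) :
    MixedDefinable β fun v e => P v e → R v e := by
  convert! (hP.and hβ (hR.not hβ)).not hβ using 3
  tauto

theorem iff [Finite κ] (hβ : 1 < β) (hP : MixedDefinable β P) (hR : MixedDefinable β R) :
    MixedDefinable β fun v e => (P v e ↔ R v e) := by
  convert! (hP.imp hβ hR).and hβ (hR.imp hβ hP) using 3
  tauto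

theorem const [Finite κ] (hβ : 1 < β) (p : Prop) :
    MixedDefinable β fun (_ : α → ℝ) (_ : κ → ℤ) => p := by
  by_cases hp : p
  · exact of_definable hβ Set.definable_univ fun v e _ => by simp [hp]
  · exact of_definable hβ Set.definable_empty fun v e _ => by simp [hp]

theorem exists_finite {ι : Type} [Finite ι] {P : ι → (α → ℝ) → (κ → ℤ) → Prop}
    (hP : ∀ q, MixedDefinable β (P q)) : MixedDefinable β fun v e => ∃ q, P q v e := by
  unfold MixedDefinable
  convert! Set.definable_iUnion_of_finite hP using 1
  ext v
  simp only [Set.mem_iUnion, Set.mem_ofPred_eq]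
  grind

theorem forall_finite [Finite κ] (hβ : 1 < β) {ι : Type} [Finite ι]
    {P : ι → (α → ℝ) → (κ → ℤ) → Prop} (hP : ∀ q, MixedDefinable β (P q)) :
    MixedDefinable β fun v e => ∀ q, P q v e := by
  convert! (exists_finite fun q => (hP q).not hβ).not hβ using 3
  push Not
  rfl

theorem exists_real [Finite α] [Finite κ] [Finite γ] {P : (α → ℝ) → (γ → ℝ) → (κ → ℤ) → Prop}
    (hP : MixedDefinable β fun (v : α ⊕ γ → ℝ) e =>
      P (fun a => v (Sum.inl a)) (fun c => v (Sum.inr c)) e) :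
    MixedDefinable β fun v e => ∃ y, P v y e := by
  unfold MixedDefinable
  convert! Set.Definable.image_comp hP (Sum.map Sum.inl id : α ⊕ κ → (α ⊕ γ) ⊕ κ) using 1
  ext v
  simp only [Set.mem_image, Set.mem_ofPred_eq]
  constructor
  · rintro ⟨e, he, y, h⟩
    refine ⟨Sum.elim (Sum.elim (fun a => v (Sum.inl a)) y) fun c => v (Sum.inr c),
      ⟨e, he, h⟩, ?_⟩
    funext c
    rcases c with c | c <;> rfl
  · rintro ⟨w, ⟨e, he, h⟩, rfl⟩
    exact ⟨e, he, _, h⟩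

/-- The condition on the new coordinate `none` includes being a power of `β`, so projecting it away
quantifies over ℤ. -/
theorem exists_int [Finite α] [Finite κ] {P : (α → ℝ) → (κ → ℤ) → ℤ → Prop}
    (hP : MixedDefinable β fun (v : α → ℝ) (e : Option κ → ℤ) =>
      P v (fun c => e (some c)) (e none)) :
    MixedDefinable β fun v e => ∃ i, P v e i := by
  unfold MixedDefinable
  convert! Set.Definable.image_comp hP (Sum.map id some : α ⊕ κ → α ⊕ Option κ) using 1
  ext v
  simp only [Set.mem_image, Set.mem_ofPred_eq]
  constructor
  · rintro ⟨e, he, i, h⟩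
    refine ⟨Sum.elim (fun a => v (Sum.inl a)) fun c => c.elim (β ^ i) fun c => v (Sum.inr c),
      ⟨fun c => c.elim i e, ?_, h⟩, ?_⟩
    · rintro (_ | c)
      · rfl
      · exact he c
    · funext c
      rcases c with c | c <;> rfl
  · rintro ⟨w, ⟨e, he, h⟩, rfl⟩
    exact ⟨_, fun c => he _, _, h⟩

theorem forall_int [Finite α] [Finite κ] (hβ : 1 < β) {P : (α → ℝ) → (κ → ℤ) → ℤ → Prop}
    (hP : MixedDefinable β fun (v : α → ℝ) (e : Option κ → ℤ) =>
      P v (fun c => e (some c)) (e none)) :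
    MixedDefinable β fun v e => ∀ i, P v e i := by
  convert! (exists_int (P := fun v e i => ¬ P v e i) (hP.not hβ)).not hβ using 3
  push Not
  rfl

theorem le [Finite κ] (hβ : 1 < β) (c d : κ) :
    MixedDefinable β fun (_ : α → ℝ) (e : κ → ℤ) => e c ≤ e d :=
  of_definable hβ (definable_setOf_le β (Sum.inr c) (Sum.inr d)) fun v e he => by
    rw [Set.mem_ofPred_eq, he, he, zpow_le_zpow_iff_right₀ hβ]

theorem lt [Finite κ] (hβ : 1 < β) (c d : κ) :
    MixedDefinable β fun (_ : α → ℝ) (e : κ → ℤ) => e c < e d := by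
  simpa only [not_le] using (le hβ d c).not hβ

theorem eq_zero [Finite κ] (hβ : 1 < β) (c : κ) :
    MixedDefinable β fun (_ : α → ℝ) (e : κ → ℤ) => e c = 0 :=
  of_definable hβ (definable_setOf_eq_one β (Sum.inr c)) fun v e he => by
    rw [Set.mem_ofPred_eq, he, zpow_eq_one_iff_right₀ (by linarith) hβ.ne']

theorem eq_add_one [Finite α] [Finite κ] (hβ : 1 < β) (c d : κ) :
    MixedDefinable β fun (_ : α → ℝ) (e : κ → ℤ) => e c = e d + 1 := by
  -- Successor is expressed by the order: `e d < e c` with no integer strictly between.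
  convert! (lt (α := α) hβ d c).and hβ
    ((exists_int (P := fun _ e i => e d < i ∧ i < e c)
      ((lt hβ (some d) none).and hβ (lt hβ none (some c)))).not hβ) using 3 with v e
  constructor
  · intro h
    refine ⟨by omega, ?_⟩
    rintro ⟨i, hi⟩
    omega
  · rintro ⟨h, h'⟩
    by_contra hne
    exact h' ⟨e d + 1, by omega, by omega⟩

theorem digit_eq [Finite κ] (hβ : 1 < β) (a : α) (c : κ) (d : ℤ) :
    MixedDefinable β fun (v : α → ℝ) (e : κ → ℤ) => digit β (v a) (e c) = d := by
  by_cases hd : |d| ≤ ⌈β⌉ - 1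
  · refine of_definable hβ (definable_setOf_digitPred β ⟨d, hd⟩ (Sum.inl a) (Sum.inr c))
      fun v e he => ?_
    rw [Set.mem_ofPred_eq, he, digitPred_zpow_iff hβ]
  · refine of_definable hβ Set.definable_empty fun v e _ => iff_of_false ?_ (Set.notMem_empty v)
    rintro rfl
    exact hd (abs_digit_le hβ _ _)

theorem definable {X : Set (α → ℝ)} (hX : MixedDefinable β fun v (_ : Empty → ℤ) => v ∈ X) :
    (∅ : Set ℝ).Definable (betaLanguage β) X := by
  convert! Set.Definable.image_comp_equiv hX (Equiv.sumEmpty α Empty).symm using 1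
  ext v
  simp only [Set.mem_image, Set.mem_ofPred_eq]
  constructor
  · intro h
    exact ⟨Sum.elim v Empty.elim, ⟨Empty.elim, fun c => c.elim, h⟩, rfl⟩
  · rintro ⟨w, ⟨e, -, h⟩, rfl⟩
    exact h

end MixedDefinable

/-! ### Words with a separator -/

/-- The sequence `f K, …, f 0, c, f (-1), f (-2), …`. -/
def insertSep {γ : Type*} (K : ℕ) (f : ℤ → γ) (c : γ) (j : ℕ) : γ :=
  if j ≤ K then f ((K : ℤ) - j) else if j = K + 1 then c else f ((K : ℤ) + 1 - j)

section InsertSep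

variable {γ : Type*} {K : ℕ} {f : ℤ → γ} {c : γ}

theorem insertSep_of_le {j : ℕ} (hj : j ≤ K) : insertSep K f c j = f ((K : ℤ) - j) :=
  if_pos hj

theorem insertSep_self : insertSep K f c (K + 1) = c := by
  simp [insertSep]

theorem insertSep_of_lt {j : ℕ} (hj : K + 1 < j) : insertSep K f c j = f ((K : ℤ) + 1 - j) := by
  rw [insertSep, if_neg (by omega), if_neg (by omega)]

theorem insertSep_of_nonneg {i : ℤ} (h0 : 0 ≤ i) (hi : i ≤ K) :
    insertSep K f c (K - i).toNat = f i := by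
  rw [insertSep_of_le (by omega)]
  congr 1
  omega

theorem insertSep_of_neg {i : ℤ} (h0 : i < 0) : insertSep K f c (K + 1 - i).toNat = f i := by
  rw [insertSep_of_lt (by omega)]
  congr 1
  omega

theorem exists_insertSep_eq (K : ℕ) (r : ℕ → γ) : ∃ f c, insertSep K f c = r := by
  -- The values of this function above `K` are irrelevant, since `insertSep` never reads them.
  refine ⟨fun i => if 0 ≤ i then r (K - i).toNat else r (K + 1 - i).toNat, r (K + 1), ?_⟩
  funext j
  rcases lt_trichotomy j (K + 1) with hj | rfl | hj
  · rw [insertSep_of_le (by omega), if_pos (by omega)]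
    congr 1
    omega
  · exact insertSep_self
  · rw [insertSep_of_lt hj, if_neg (by omega)]
    congr 1
    omega

theorem insertSep_succ_of_pos {i : ℤ} (h0 : 0 < i) (hi : i ≤ K) :
    insertSep K f c ((K - i).toNat + 1) = f (i - 1) := by
  rw [← insertSep_of_nonneg (f := f) (c := c) (by omega : 0 ≤ i - 1) (by omega : i - 1 ≤ K)]
  congr 1
  omega

theorem insertSep_succ_of_neg {i : ℤ} (h0 : i < 0) :
    insertSep K f c ((K + 1 - i).toNat + 1) = f (i - 1) := by
  rw [← insertSep_of_neg (K := K) (f := f) (c := c) (by omega : i - 1 < 0)]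
  congr 1
  omega

end InsertSep

/-! ### Expansions as words -/

/-- The letter of the `β`-expansion of the point `x` at the position `i`. -/
noncomputable def digitLetter {n : ℕ} {β : ℝ} (hβ : 1 < β) (x : Fin n → ℝ) (i : ℤ) :
    Fin n → Digit β :=
  fun c => ⟨digit β (x c) i, abs_digit_le hβ _ _⟩

/-- The `β`-expansion of the point `x` as an infinite word, if its leading position is `K`. -/
noncomputable def expansionWord {n : ℕ} {β : ℝ} (hβ : 1 < β) (x : Fin n → ℝ) (K : ℕ) :
    ℕ → Letter β n :=
  insertSep K (fun i => some (digitLetter hβ x i)) none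

theorem map_expansionWord {n : ℕ} {β : ℝ} (hβ : 1 < β) (x : Fin n → ℝ) (K j : ℕ) :
    (expansionWord hβ x K j).map (fun a i => (a i : ℤ)) =
      syncWord K (fun i => digit β (x i)) j := by
  unfold expansionWord insertSep syncWord
  split_ifs <;> rfl

theorem exists_isLeading {n : ℕ} {β : ℝ} (hβ : 1 < β) (x : Fin n → ℝ) :
    ∃ K : ℕ, IsLeading β x K := by
  classical
  have hex : ∃ K : ℕ, ∀ i (j : ℤ), K < j → digit β (x i) j = 0 := by
    choose k hk using fun i => exists_isExpansion_digit hβ (x i)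
    refine ⟨Finset.univ.sup k, fun i j hj => ?_⟩
    have : k i ≤ Finset.univ.sup k := Finset.le_sup (Finset.mem_univ i)
    simpa using (hk i).greedy_abs.1.zero_above j (by omega)
  refine ⟨Nat.find hex, by omega, Nat.find_spec hex, ?_⟩
  by_contra! h
  have hlt : Nat.find hex - 1 < Nat.find hex := by omega
  refine Nat.find_min hex hlt fun i j hj => ?_
  rcases eq_or_ne j (Nat.find hex) with rfl | hne
  · exact h.2 i
  · exact Nat.find_spec hex i j (by omega)

/-- For the converse, the place of the separator determines `K`, and the letters then determine all
digits up to `K`, hence the point as their sum. -/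
theorem mem_iff_expansionWord_mem {n : ℕ} {β : ℝ} (hβ : 1 < β) (X : Set (Fin n → ℝ))
    (x : Fin n → ℝ) :
    x ∈ X ↔ ∃ K : ℕ, IsLeading β x K ∧ expansionWord hβ x K ∈ expansionLanguage β X := by
  constructor
  · intro hx
    obtain ⟨K, hK⟩ := exists_isLeading hβ x
    exact ⟨K, hK, x, hx, K, _, (isVecExpansion_iff hβ x K _).2 ⟨hK, rfl⟩, map_expansionWord hβ x K⟩
  · rintro ⟨K, hK, x', hx', K', u, hu, hw⟩
    simp only [map_expansionWord] at hw
    obtain rfl : K = K' := by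
      have h := hw (K + 1)
      unfold syncWord at h
      split_ifs at h <;> omega
    have hdig (i : Fin n) (p : ℤ) (hp : p ≤ K) : digit β (x i) p = u i p := by
      rcases lt_or_ge p 0 with h0 | h0
      · have h := hw (K + 1 - p).toNat
        unfold syncWord at h
        rw [if_neg (by omega), if_neg (by omega), if_neg (by omega), if_neg (by omega),
          show (K : ℤ) + 1 - (K + 1 - p).toNat = p by omega] at h
        exact congrFun (Option.some_injective _ h) i
      · have h := hw (K - p).toNat
        unfold syncWord at h
        rw [if_pos (by omega), if_pos (by omega),
          show (K : ℤ) - (K - p).toNat = p by omega] at h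
        exact congrFun (Option.some_injective _ h) i
    suffices x = x' from this ▸ hx'
    funext i
    obtain ⟨k, hk, he⟩ := ((isVecExpansion_iff hβ x K _).2 ⟨hK, rfl⟩).1 i
    obtain ⟨k', hk', he'⟩ := hu.1 i
    have hs := he.hasSum hβ hk
    simp only [hdig i _ (sub_le_self (K : ℤ) (Int.natCast_nonneg _))] at hs
    exact hs.unique (he'.hasSum hβ hk')

/-! ### Runs of Büchi automata -/

/-- The relation `R` between positions and states describes an accepting run of `M` on the
`β`-expansion of `x` with the leading position `K`: `R i q` holds if the letter at the position `i`
is read in the state `q`, and the separator is read in the state `p`. -/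
structure IsAcceptingRun {n : ℕ} {β : ℝ} {Q : Type} (M : NFA (Letter β n) Q) (x : Fin n → ℝ)
    (K : ℤ) (p : Q) (R : ℤ → Q → Prop) : Prop where
  exists_state : ∀ i, i ≤ K → ∃ q, ∀ q', R i q' ↔ q = q'
  start : ∃ q, q ∈ M.start ∧ R K q
  step : ∀ i j, i ≤ K → i = j + 1 → ∃ (q q' : Q) (a : Fin n → Digit β),
    R i q ∧ R j q' ∧ (∀ c, digit β (x c) i = a c) ∧
      ((¬ i = 0 ∧ q' ∈ M.step q (some a)) ∨
        (i = 0 ∧ p ∈ M.step q (some a) ∧ q' ∈ M.step p none))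
  accept : ∀ i, i ≤ K → ∃ j, j < i ∧ ∃ q, q ∈ M.accept ∧ R j q

variable {n : ℕ} {β : ℝ} {Q : Type} {M : NFA (Letter β n) Q}

theorem IsAcceptingRun.congr {x : Fin n → ℝ} {K : ℤ} {p : Q} {R R' : ℤ → Q → Prop}
    (h : IsAcceptingRun M x K p R) (hR : ∀ i, i ≤ K → ∀ q, R i q ↔ R' i q) :
    IsAcceptingRun M x K p R' where
  exists_state i hi := by simpa only [hR i hi] using h.exists_state i hi
  start := by simpa only [hR K le_rfl] using h.start
  step i j hi hij := by
    simpa only [hR i hi, hR j (by omega)] using h.step i j hi hij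
  accept i hi := by
    obtain ⟨j, hj, q, hq, hjq⟩ := h.accept i hi
    exact ⟨j, hj, q, hq, (hR j (by omega) q).1 hjq⟩

/-- Late indices correspond to low positions, and the separator together with the integer part
occupies only finitely many indices. -/
theorem frequently_insertSep_iff {K : ℕ} {s : ℤ → Q} {p : Q} {A : Set Q} :
    (∃ᶠ j in atTop, insertSep K s p j ∈ A) ↔ ∀ i : ℤ, i ≤ K → ∃ j, j < i ∧ s j ∈ A := by
  rw [frequently_atTop]
  constructor
  · intro h i hi
    obtain ⟨b, hb, hA⟩ := h (K + 2 - i + K + 2).toNat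
    rw [insertSep_of_lt (by omega)] at hA
    exact ⟨_, by omega, hA⟩
  · intro h N
    obtain ⟨j, hj, hA⟩ := h (-N) (by omega)
    exact ⟨(K + 1 - j).toNat, by omega, by rwa [insertSep_of_neg (by omega)]⟩

/-- Away from position `0` one step of positions is one transition. At position `0` it is two, the
second of which reads the separator in state `p`. -/
theorem isAcceptingRun_iff (hβ : 1 < β) {x : Fin n → ℝ} {K : ℕ} {p : Q} {s : ℤ → Q} :
    IsAcceptingRun M x K p (fun i q => s i = q) ↔
      insertSep K s p 0 ∈ M.start ∧
      (∀ j, insertSep K s p (j + 1) ∈ M.step (insertSep K s p j) (expansionWord hβ x K j)) ∧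
      ∃ᶠ j in atTop, insertSep K s p j ∈ M.accept := by
  have h0 : insertSep K s p 0 = s K := by simp [insertSep]
  have hK : insertSep K s p K = s 0 := by simp [insertSep]
  have hwK : expansionWord hβ x K K = some (digitLetter hβ x 0) := by
    simp [expansionWord, insertSep]
  have hK2 : insertSep K s p (K + 1 + 1) = s (-1) := by
    rw [insertSep_of_lt (by omega)]
    congr 1
    omega
  have hw1 : expansionWord hβ x K (K + 1) = none := insertSep_self
  rw [frequently_insertSep_iff, h0]
  constructor
  · rintro ⟨-, ⟨q, hq, hKq⟩, hstep, hacc⟩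
    have hstep' (i : ℤ) (hi : i ≤ K) :
        (¬ i = 0 ∧ s (i - 1) ∈ M.step (s i) (some (digitLetter hβ x i))) ∨
        (i = 0 ∧ p ∈ M.step (s i) (some (digitLetter hβ x i)) ∧ s (i - 1) ∈ M.step p none) := by
      obtain ⟨q, q', a, rfl, rfl, ha, h⟩ := hstep i (i - 1) hi (by omega)
      have : digitLetter hβ x i = a := funext fun c => Subtype.ext (ha c)
      rwa [this]
    refine ⟨by rwa [hKq], fun j => ?_, fun i hi => ?_⟩
    · rcases lt_trichotomy j (K + 1) with hj | rfl | hj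
      · rcases eq_or_ne j K with rfl | hne
        · rw [insertSep_self, hK, hwK]
          rcases hstep' 0 (by omega) with h | h
          · exact absurd rfl h.1
          · exact h.2.1
        · rw [insertSep_of_le (by omega), insertSep_of_le (by omega), expansionWord,
            insertSep_of_le (by omega), Nat.cast_add_one, ← sub_sub]
          rcases hstep' (K - j) (by omega) with h | h
          · exact h.2
          · omega
      · rw [hK2, insertSep_self, hw1]
        rcases hstep' 0 (by omega) with h | h
        · exact absurd rfl h.1
        · exact h.2.2
      · rw [insertSep_of_lt (by omega), insertSep_of_lt (by omega), expansionWord,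
          insertSep_of_lt (by omega), Nat.cast_add_one, ← sub_sub]
        rcases hstep' (K + 1 - j) (by omega) with h | h
        · exact h.2
        · omega
    · obtain ⟨j, hj, q, hq, rfl⟩ := hacc i hi
      exact ⟨j, hj, hq⟩
  · rintro ⟨hstart, hstep, hacc⟩
    refine ⟨fun i _ => ⟨s i, fun _ => Iff.rfl⟩, ⟨_, hstart, rfl⟩, ?_, fun i hi => ?_⟩
    · rintro i j hi rfl
      refine ⟨_, _, digitLetter hβ x (j + 1), rfl, rfl, fun c => rfl, ?_⟩
      rcases lt_trichotomy (j + 1) 0 with hj | hj | hj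
      · refine Or.inl ⟨hj.ne, ?_⟩
        have h := hstep (K + 1 - (j + 1)).toNat
        rwa [insertSep_succ_of_neg hj, insertSep_of_neg hj, expansionWord, insertSep_of_neg hj,
          add_sub_cancel_right] at h
      · refine Or.inr ⟨hj, ?_⟩
        have h := hstep K
        have h' := hstep (K + 1)
        rw [insertSep_self, hK, hwK] at h
        rw [hK2, insertSep_self, hw1] at h'
        obtain rfl : j = -1 := by omega
        exact ⟨h, h'⟩
      · refine Or.inl ⟨hj.ne', ?_⟩
        have h := hstep (K - (j + 1)).toNat
        rwa [insertSep_succ_of_pos hj hi, insertSep_of_nonneg hj.le hi, expansionWord,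
          insertSep_of_nonneg hj.le hi, add_sub_cancel_right] at h
    · obtain ⟨j, hj, h⟩ := hacc i hi
      exact ⟨j, hj, _, h, rfl⟩

theorem expansionWord_mem_buchiLanguage_iff (hβ : 1 < β) {m : ℕ}
    (hm : ∀ (s : ℤ → Q) (K : ℕ), ∃ y : Fin m × Q → ℝ, ∀ i ≤ (K : ℤ), ∀ q,
      (∃ r, digit β (y (r, q)) i = 1) ↔ s i = q) (x : Fin n → ℝ) (K : ℕ) :
    expansionWord hβ x K ∈ buchiLanguage M ↔ ∃ (y : Fin m × Q → ℝ) (p : Q),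
      IsAcceptingRun M x K p fun i q => ∃ r, digit β (y (r, q)) i = 1 := by
  constructor
  · rintro ⟨r, hr⟩
    obtain ⟨s, p, rfl⟩ := exists_insertSep_eq K r
    obtain ⟨y, hy⟩ := hm s K
    exact ⟨y, p, ((isAcceptingRun_iff hβ).2 hr).congr fun i hi q => (hy i hi q).symm⟩
  · rintro ⟨y, p, h⟩
    -- `choose!` needs a default state for positions above `K`, where the digits of `y` are
    -- unconstrained.
    have : Nonempty Q := ⟨p⟩
    choose! s hs using h.exists_state
    exact ⟨_, (isAcceptingRun_iff hβ).1 (h.congr hs)⟩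

open MixedDefinable

theorem mixedDefinable_isLeading (hβ : 1 < β) {α κ : Type} [Finite α] [Finite κ]
    (g : Fin n → α) (k : κ) :
    MixedDefinable β fun (v : α → ℝ) (e : κ → ℤ) => IsLeading β (fun i => v (g i)) (e k) := by
  -- Position `0` is not among the variables, so it is introduced by an existential quantifier.
  have h0 : MixedDefinable β fun (_ : α → ℝ) (e : κ → ℤ) => 0 ≤ e k := by
    convert! exists_int (α := α) (P := fun _ e i => i = 0 ∧ i ≤ e k)
      ((MixedDefinable.eq_zero hβ none).and hβ (MixedDefinable.le hβ none (some k))) using 3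
    simp
  refine h0.and hβ (.and hβ ?_ (.or hβ (.eq_zero hβ k) ?_))
  · exact forall_finite hβ fun i => forall_int hβ <|
      .imp hβ (.lt hβ (some k) none) (.digit_eq hβ (g i) none 0)
  · exact exists_finite fun i => .not hβ (.digit_eq hβ (g i) k 0)

theorem isAcceptingRun_def {x : Fin n → ℝ} {K : ℤ} {p : Q} {R : ℤ → Q → Prop} :
    IsAcceptingRun M x K p R ↔
      (∀ i, i ≤ K → ∃ q, ∀ q', R i q' ↔ q = q') ∧ (∃ q, q ∈ M.start ∧ R K q) ∧
      (∀ i j, i ≤ K → i = j + 1 → ∃ (q q' : Q) (a : Fin n → Digit β),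
        R i q ∧ R j q' ∧ (∀ c, digit β (x c) i = a c) ∧
          ((¬ i = 0 ∧ q' ∈ M.step q (some a)) ∨
            (i = 0 ∧ p ∈ M.step q (some a) ∧ q' ∈ M.step p none))) ∧
      ∀ i, i ≤ K → ∃ j, j < i ∧ ∃ q, q ∈ M.accept ∧ R j q :=
  ⟨fun h => ⟨h.1, h.2, h.3, h.4⟩, fun h => ⟨h.1, h.2.1, h.2.2.1, h.2.2.2⟩⟩

/-- States and letters range over finite sets, so quantifiers over them become finite disjunctions
and conjunctions, and membership in `M.start`, `M.step` or `M.accept` becomes a constant. -/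
theorem mixedDefinable_isAcceptingRun [Finite Q] (hβ : 1 < β) {α κ : Type} [Finite α] [Finite κ]
    {m : ℕ} (g : Fin n → α) (y : Fin m × Q → α) (k : κ) (p : Q) :
    MixedDefinable β fun (v : α → ℝ) (e : κ → ℤ) =>
      IsAcceptingRun M (fun i => v (g i)) (e k) p fun i q => ∃ r, digit β (v (y (r, q))) i = 1 := by
  simp only [isAcceptingRun_def]
  -- The index type is generalized because each quantifier over positions wraps it in one more
  -- `Option`.
  have hR {κ : Type} [Finite κ] (c : κ) (q : Q) : MixedDefinable β
      fun (v : α → ℝ) (e : κ → ℤ) => ∃ r, digit β (v (y (r, q))) (e c) = 1 :=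
    exists_finite fun r => .digit_eq hβ _ _ _
  refine .and hβ ?_ (.and hβ ?_ (.and hβ ?_ ?_))
  · exact forall_int hβ <| .imp hβ (.le hβ none (some k)) <| exists_finite fun q =>
      forall_finite hβ fun q' => .iff hβ (hR none q') (.const hβ _)
  · exact exists_finite fun q => .and hβ (.const hβ _) (hR k q)
  -- Under the two quantifiers, `some none` is `i`, `none` is `j`, and `some (some k)` is the
  -- leading position.
  · refine forall_int hβ <| forall_int hβ <| .imp hβ (.le hβ (some none) (some (some k))) <|
      .imp hβ (.eq_add_one hβ (some none) none) <| exists_finite fun q => exists_finite fun q' =>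
      exists_finite fun a => .and hβ (hR (some none) q) <| .and hβ (hR none q') <|
      .and hβ (forall_finite hβ fun c => .digit_eq hβ (g c) (some none) _) <| .or hβ ?_ ?_
    · exact .and hβ (.not hβ (.eq_zero hβ (some none))) (.const hβ _)
    · exact .and hβ (.eq_zero hβ (some none)) (.const hβ _)
  · exact forall_int hβ <| .imp hβ (.le hβ none (some k)) <| exists_int <|
      .and hβ (.lt hβ none (some none)) <| exists_finite fun q =>
      .and hβ (.const hβ _) (hR none q)

end BetaNumeration

open BetaNumeration in
theorem mainTheorem3 (β : ℝ) (hβ : 1 < β) (hParry : BetaNumeration.IsParry β)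
    (n : ℕ) (hn : 1 ≤ n) (X : Set (Fin n → ℝ)) (hX : BetaNumeration.Recognizable β X) :
    BetaNumeration.BetaDefinable β X := by
  obtain ⟨Q, _, M, hM⟩ := hX
  obtain ⟨m, hm⟩ := exists_encoding hβ
  refine MixedDefinable.definable ?_
  have key (x : Fin n → ℝ) : x ∈ X ↔ ∃ (y : Fin m × Q → ℝ) (K : ℤ), IsLeading β x K ∧
      ∃ p, IsAcceptingRun M x K p fun i q => ∃ r, digit β (y (r, q)) i = 1 := by
    rw [mem_iff_expansionWord_mem hβ, ← hM]
    simp only [expansionWord_mem_buchiLanguage_iff hβ (hm Q)]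
    constructor
    · rintro ⟨K, hK, y, p, h⟩
      exact ⟨y, K, hK, p, h⟩
    · rintro ⟨y, K, hK, p, h⟩
      -- The formula quantifies over all integers, but `IsLeading` forces `0 ≤ K`.
      lift K to ℕ using hK.1
      exact ⟨K, hK, y, p, h⟩
  simp only [key]
  exact .exists_real <| .exists_int <| .and hβ (mixedDefinable_isLeading hβ Sum.inl none)
    (.exists_finite fun p => mixedDefinable_isAcceptingRun hβ Sum.inl Sum.inr none p)
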